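/- Let $m\ge 0$ be the number of candidates $C_1,\dots,C_m$, and let $p$ be an arbitrary probability distribution on the $m!$ strict rankings of the candidates. Let the voters $v=1,2,\dots$ have independent random rankings, each with distribution $p$. Among the first $n$ voters, $C_i$ beats $C_j$ if strictly more of them rank $C_i$ above $C_j$ than $C_j$ above $C_i$; the pair is tied if the two numbers are equal; and $C_i$ is the Condorcet winner if it beats every $C_j$, $j\neq i$. For $i\ne j$ let $X(i,j)=1$ if a voter ranks $C_i$ above $C_j$ and $X(i,j)=-1$ otherwise, and let $\lambda_{ij}=\mathbb E[X(i,j)]$. Put $\delta_{ij}=-\infty$ if $\lambda_{ij}>0$, $\delta_{ij}=+\infty$ if $\lambda_{ij}<0$, and $\delta_{ij}=0$ if $\lambda_{ij}=0$. For each $i$ let $R_i=(R^{(i)}_{jl})_{j,l\neq i}$ be the $(m-1)\times(m-1)$ correlation matrix of the variables $X(i,j)$, $j\ne i$, that is, $R^{(i)}_{jj}=1$ and, for $j\neq l$, $$R^{(i)}_{jl}=\frac{\operatorname{Cov}(X(i,j),X(i,l))}{\sqrt{\operatorname{Var}X(i,j)\,\operatorname{Var}X(i,l)}},$$ where an off-diagonal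 entry is taken to be $0$ if one of the two variances is $0$. For a positive semidefinite matrix $R$ with unit diagonal and $h_k\in[-\infty,\infty]$, let $L(h_1,\dots,h_d;R)=P(Z_1\ge h_1,\dots,Z_d\ge h_d)$, where $Z$ is a (possibly degenerate) normal vector with mean $0$ and covariance matrix $R$ (for $d=0$ this is $1$). Then: 1. Each $R_i$ is positive semidefinite. 2. As $n\to\infty$ (through all integers, odd and even), for each $i$ the probability that $C_i$ is the Condorcet winner among $n$ voters tends to $L\big((\delta_{ij})_{j\ne i};R_i\big)$, and the probability that there is a Condorcet winner tends to $$P(\infty,m)=\sum_{i=1}^m L\big(\delta_{i1},\dots,\delta_{i,i-1},\delta_{i,i+1},\dots,\delta_{im};R_i\big).$$ 3. If $\delta_{ij}=+\infty$ for some $j\neq i$, then the $i$-th term of this sum is $0$. Otherwise the $i$-th term is the positive-orthant probability $L(0,\dots,0;R_i')$, where $R_i'$ is the submatrix of $R_i$ with rows and columns in $\{j\ne i:\delta_{ij}=0\}$, i.e. of the marginal normal distribution on these coordinates. 4. For all $i\ne j$, the probability that $C_i$ and $C_j$ are tied among $n$ voters tends to $0$ as $n\to\infty$. -/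

import Mathlib

open MeasureTheory ProbabilityTheory Filter Topology

noncomputable section

/-- A strict preference ranking of the `m` candidates `0, …, m - 1`: the permutation `r` sends
a candidate `c` to its place `r c` in the ranking (place `0` is the top). There are `m!` of them. -/
def Ranking (m : ℕ) : Type := Equiv.Perm (Fin m)

namespace Ranking

variable {m : ℕ}

instance : Fintype (Ranking m) := inferInstanceAs (Fintype (Equiv.Perm (Fin m)))

instance : DecidableEq (Ranking m) := inferInstanceAs (DecidableEq (Equiv.Perm (Fin m)))

/-- Every set of rankings is an event. -/
instance : MeasurableSpace (Ranking m) := ⊤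

instance : DiscreteMeasurableSpace (Ranking m) := ⟨fun _ => trivial⟩

/-- The place of candidate `c` in the ranking `r`. -/
def place (r : Ranking m) (c : Fin m) : Fin m := Equiv.toFun r c

/-- The ranking `r` prefers candidate `i` to candidate `j`. -/
def Prefers (r : Ranking m) (i j : Fin m) : Prop := r.place i < r.place j

instance (r : Ranking m) (i j : Fin m) : Decidable (r.Prefers i j) :=
  inferInstanceAs (Decidable (r.place i < r.place j))

end Ranking

/-- The number of voters of the profile `σ` who prefer candidate `i` to candidate `j`. -/
def votesFor {m n : ℕ} (σ : Fin n → Ranking m) (i j : Fin m) : ℕ :=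
  (Finset.univ.filter fun v => (σ v).Prefers i j).card

/-- Candidate `i` beats candidate `j` by majority rule. -/
def Beats {m n : ℕ} (σ : Fin n → Ranking m) (i j : Fin m) : Prop :=
  votesFor σ j i < votesFor σ i j

/-- The majority comparison of the candidates `i` and `j` is a tie. -/
def IsTie {m n : ℕ} (σ : Fin n → Ranking m) (i j : Fin m) : Prop :=
  votesFor σ i j = votesFor σ j i

/-- Candidate `i` is the (strong) Condorcet winner: it beats every other candidate. -/
def IsCondorcetWinner {m n : ℕ} (σ : Fin n → Ranking m) (i : Fin m) : Prop :=
  ∀ j, j ≠ i → Beats σ i j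

/-- The score `X(i,j)` of a single voter with ranking `r`: `1` if `i` is preferred to `j`,
and `-1` otherwise. It is used for `i ≠ j` only. -/
def prefScore {m : ℕ} (i j : Fin m) (r : Ranking m) : ℝ :=
  if r.Prefers i j then 1 else -1

/-- `λ_{ij}`, the expectation of `X(i,j)` for a voter whose ranking has distribution `p`. -/
def lam {m : ℕ} (p : PMF (Ranking m)) (i j : Fin m) : ℝ :=
  ∫ r, prefScore i j r ∂p.toMeasure

/-- The candidates other than `i`. -/
abbrev Opponent {m : ℕ} (i : Fin m) : Type := {j : Fin m // j ≠ i}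

/-- The correlation matrix `R_i` of the scores `X(i,j)`, `j ≠ i`. The diagonal entries are `1`.
An off-diagonal entry in which one of the two scores is almost surely constant, so that the
correlation coefficient is undefined, is `0` (through division by zero). -/
def corrMatrix {m : ℕ} (p : PMF (Ranking m)) (i : Fin m) :
    Matrix (Opponent i) (Opponent i) ℝ := fun j l =>
  if j = l then 1
  else cov[prefScore i j.1, prefScore i l.1; p.toMeasure] /
    Real.sqrt (Var[prefScore i j.1; p.toMeasure] * Var[prefScore i l.1; p.toMeasure])

/-- `δ_{ij}`, which is `-∞`, `+∞` or `0` according as `λ_{ij}` is positive, negative or zero. -/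
def delta {m : ℕ} (p : PMF (Ranking m)) (i : Fin m) (j : Opponent i) : EReal :=
  if 0 < lam p i j.1 then ⊥ else if lam p i j.1 < 0 then ⊤ else 0

/-- `L(h; R) = P(Z_k ≥ h_k for all k)`, where `Z` is a centred normal vector with covariance
matrix `R`. The thresholds `h_k` are extended real numbers. -/
def normalOrthant {ι : Type*} [Fintype ι] [DecidableEq ι] (h : ι → EReal) (R : Matrix ι ι ℝ) : ℝ :=
  (multivariateGaussian (0 : EuclideanSpace ℝ ι) R).real {z | ∀ k, h k ≤ ((z k : ℝ) : EReal)}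

end

/-! `C_i` beats `C_j` exactly when the partial sum of the scores `X(i,j)` is positive. If `λ_{ij} ≠
0`, the law of large numbers fixes the sign of this sum with probability tending to 1
(`tendsto_measure_not_beats`), so the opponent is either negligible or fatal. If `λ_{ij} = 0`, then
`X² = 1` gives variance 1, correlations among such opponents are plain covariances, and the central
limit theorem makes the margins divided by `√n` jointly normal (`tendsto_measure_margins`).

The limit may be degenerate, but its coordinates are standard normal, so every hyperplane `z k = 0`
is null. Hence the orthant has null boundary, strict and weak inequalities agree in the limit, and
ties vanish whatever the parity of `n`. Condorcet winners are unique, so the probabilities for the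
separate candidates add. -/

/-! ### Covariance matrices, normal vectors and the two limit theorems -/

/-- The matrix of covariances of finitely many square integrable variables is positive
semidefinite. -/
theorem posSemidef_covariance {ι Ω : Type*} [Fintype ι] [MeasurableSpace Ω] {μ : Measure Ω}
    [IsFiniteMeasure μ] {Y : ι → Ω → ℝ} (hY : ∀ j, MemLp (Y j) 2 μ) :
    (Matrix.of fun j l => cov[Y j, Y l; μ]).PosSemidef := by
  refine Matrix.PosSemidef.of_dotProduct_mulVec_nonneg ?_ fun x => ?_
  · exact Matrix.IsHermitian.ext fun j l => covariance_comm _ _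
  · have h := covariance_fun_sum_fun_sum (μ := μ) (X := fun j ω => x j * Y j ω)
      (Y := fun j ω => x j * Y j ω) (fun j => (hY j).const_mul _) (fun j => (hY j).const_mul _)
    have h0 : 0 ≤ cov[fun ω => ∑ j, x j * Y j ω, fun ω => ∑ j, x j * Y j ω; μ] := by
      rw [covariance_self]
      · exact variance_nonneg _ _
      · exact Finset.aemeasurable_fun_sum _ fun j _ =>
          (hY j).aestronglyMeasurable.aemeasurable.const_mul _
    rw [h] at h0
    refine h0.trans_eq ?_
    simp only [dotProduct, Matrix.mulVec, Matrix.of_apply, Finset.mul_sum, star_trivial,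
      covariance_const_mul_left, covariance_const_mul_right]
    refine Finset.sum_congr rfl fun j _ => Finset.sum_congr rfl fun l _ => ?_
    ring

/-- Selecting coordinates of a normal vector gives the normal vector whose covariance matrix is
the corresponding submatrix. -/
theorem map_comp_multivariateGaussian {ι κ : Type*} [Fintype ι] [DecidableEq ι] [Fintype κ]
    [DecidableEq κ] (e : κ → ι) {S : Matrix ι ι ℝ} (hS : S.PosSemidef) :
    (multivariateGaussian (0 : EuclideanSpace ℝ ι) S).map
        (fun x => WithLp.toLp 2 fun k => x (e k)) =
      multivariateGaussian (0 : EuclideanSpace ℝ κ) (S.submatrix e e) := by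
  let L : EuclideanSpace ℝ ι →L[ℝ] EuclideanSpace ℝ κ :=
    (PiLp.continuousLinearEquiv 2 ℝ fun _ : κ => ℝ).symm.toContinuousLinearMap ∘L
      ContinuousLinearMap.pi fun k => EuclideanSpace.proj (e k)
  change (multivariateGaussian (0 : EuclideanSpace ℝ ι) S).map L = _
  apply IsGaussian.ext
  · simp only [id_eq, integral_id_multivariateGaussian]
    rw [ContinuousLinearMap.integral_id_map, integral_id_multivariateGaussian, map_zero]
    exact IsGaussian.integrable_id
  rw [← ContinuousLinearMap.toBilinForm_inj]
  refine LinearMap.BilinForm.ext_basis (EuclideanSpace.basisFun κ ℝ).toBasis fun i j => ?_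
  rw [ContinuousLinearMap.toBilinForm_apply, ContinuousLinearMap.toBilinForm_apply,
    covarianceBilin_apply_eq_cov, covariance_map]
  · have (i : κ) : (fun u => inner ℝ ((EuclideanSpace.basisFun κ ℝ).toBasis i) u) ∘ L =
        fun u => u (e i) := by ext; simp [PiLp.inner_apply, L]
    simp_rw [this, covariance_eval_multivariateGaussian hS,
      covarianceBilin_multivariateGaussian (hS.submatrix _)]
    simp
  any_goals exact Measurable.aestronglyMeasurable (by fun_prop)
  · fun_prop
  · exact IsGaussian.memLp_two_id

/-- **Central limit theorem** in several dimensions. -/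
theorem tendstoInDistribution_inv_sqrt_smul_sum {ι Ω : Type*} [Fintype ι] [DecidableEq ι]
    [MeasurableSpace Ω] {P : Measure Ω} [IsProbabilityMeasure P]
    {X : ℕ → Ω → EuclideanSpace ℝ ι} {S : Matrix ι ι ℝ}
    (hX : MemLp (X 0) 2 P) (hmean : P[X 0] = 0)
    (hcov : ∀ j l, cov[fun ω => X 0 ω j, fun ω => X 0 ω l; P] = S j l)
    (hindep : iIndepFun X P) (hident : ∀ k, IdentDistrib (X k) (X 0) P P) :
    TendstoInDistribution (fun (n : ℕ) ω => (√n)⁻¹ • ∑ k ∈ Finset.range n, X k ω) atTop id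
      (fun _ => P) (multivariateGaussian 0 S) where
  forall_aemeasurable n :=
    .fun_const_smul (Finset.aemeasurable_fun_sum _ fun _ _ => (hident _).aemeasurable_fst) _
  tendsto := by
    have mX k := (hident k).aemeasurable_fst
    have hcoord (j : ι) : MemLp (fun ω => X 0 ω j) 2 P :=
      (EuclideanSpace.proj (𝕜 := ℝ) j).comp_memLp' hX
    have hS : S.PosSemidef := by
      convert posSemidef_covariance hcoord
      ext j l
      exact (hcov j l).symm
    refine ProbabilityMeasure.tendsto_iff_tendsto_charFun.2 fun t => ?_
    -- Cramér–Wold: the characteristic function at `t` is that of the scalar variable `⟨t, X⟩` at 1,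
    -- to which the real central limit theorem applies.
    let L : EuclideanSpace ℝ ι →L[ℝ] ℝ := innerSL ℝ t
    have hmap {ν : Measure Ω} {Z : Ω → EuclideanSpace ℝ ι} (hZ : AEMeasurable Z ν) :
        charFun (ν.map Z) t = charFun (ν.map fun ω => L (Z ω)) 1 := by
      rw [charFun_apply, charFun_apply, integral_map hZ (by fun_prop),
        integral_map (by fun_prop) (by fun_prop)]
      simp [L, real_inner_comm]
    have hvar : Var[fun ω => L (X 0 ω); P] = t ⬝ᵥ S.mulVec t := by
      have hL : (fun ω => L (X 0 ω)) = fun ω => ∑ j, t j * X 0 ω j := by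
        ext ω
        simp [L, PiLp.inner_apply, mul_comm]
      rw [hL, ← covariance_self (Finset.aemeasurable_fun_sum _ fun j _ =>
          (hcoord j).aestronglyMeasurable.aemeasurable.const_mul _),
        covariance_fun_sum_fun_sum (fun j => (hcoord j).const_mul _)
          (fun j => (hcoord j).const_mul _)]
      simp only [covariance_const_mul_left, covariance_const_mul_right, hcov, dotProduct,
        Matrix.mulVec, Finset.mul_sum]
      refine Finset.sum_congr rfl fun j _ => Finset.sum_congr rfl fun l _ => ?_
      ring
    have key := tendstoInDistribution_inv_sqrt_mul_sum_sub (X := fun k ω => L (X k ω))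
      (Y := id) (P' := gaussianReal 0 Var[fun ω => L (X 0 ω); P].toNNReal) (P := P)
      HasLaw.id (L.comp_memLp' hX)
      (hindep.comp (fun _ x => L x) fun _ => by fun_prop)
      (fun k => (hident k).comp (u := fun x => L x) (by fun_prop))
    have key1 := ProbabilityMeasure.tendsto_iff_tendsto_charFun.1 key.tendsto 1
    have hL0 : ∫ ω, L (X 0 ω) ∂P = 0 := by
      rw [L.integral_comp_comm (hX.integrable (by norm_num)), hmean, map_zero]
    simp only [ProbabilityMeasure.coe_mk, Measure.map_id, charFun_gaussianReal, hL0] at key1 ⊢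
    rw [charFun_multivariateGaussian hS]
    rw [hvar] at key1
    have hnn : 0 ≤ t ⬝ᵥ S.mulVec t := by rw [← hvar]; exact variance_nonneg _ _
    convert key1 using 2 with n
    · rw [hmap (.fun_const_smul (Finset.aemeasurable_fun_sum _ fun _ _ => mX _) _)]
      simp
    · congr 1
      simp [Real.coe_toNNReal _ hnn]

/-- If independent, identically distributed variables have positive mean, then their partial
sums are positive with probability tending to one. -/
theorem tendsto_measure_sum_nonpos {Ω : Type*} [MeasurableSpace Ω] {P : Measure Ω}
    [IsProbabilityMeasure P] {X : ℕ → Ω → ℝ} (hint : Integrable (X 0) P) (hpos : 0 < P[X 0])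
    (hindep : iIndepFun X P) (hident : ∀ k, IdentDistrib (X k) (X 0) P P) :
    Tendsto (fun n : ℕ => P.real {ω | ∑ k ∈ Finset.range n, X k ω ≤ 0}) atTop (𝓝 0) := by
  have hlln := strong_law_ae_real X hint (fun i j hij => hindep.indepFun hij) hident
  have hm := tendstoInMeasure_of_tendsto_ae
    (f := fun (n : ℕ) ω => (∑ k ∈ Finset.range n, X k ω) / n) (g := fun _ => P[X 0])
    (μ := P) (fun n => ?_) hlln
  · have h := tendstoInMeasure_iff_measureReal_norm.1 hm _ hpos
    -- A nonpositive average misses the mean by at least the mean itself, which serves as the `ε` of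
    -- convergence in measure.
    refine squeeze_zero (fun _ => measureReal_nonneg) (fun n => measureReal_mono fun ω hω => ?_) h
    have : (∑ k ∈ Finset.range n, X k ω) / n ≤ 0 :=
      div_nonpos_of_nonpos_of_nonneg hω (Nat.cast_nonneg _)
    rw [Set.mem_ofPred_eq, Real.norm_eq_abs, abs_sub_comm]
    exact (by linarith : _ ≤ P[X 0] - (∑ k ∈ Finset.range n, X k ω) / n).trans (le_abs_self _)
  · exact ((Finset.aemeasurable_fun_sum _ fun _ _ =>
      (hident _).aemeasurable_fst).div_const _).aestronglyMeasurable

/-! ### Majority comparisons as signs of score sums -/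

section Votes

variable {m n : ℕ} {i j : Fin m}

theorem Ranking.prefers_swap (hij : i ≠ j) (r : Ranking m) : r.Prefers j i ↔ ¬ r.Prefers i j := by
  have hne : r.place i ≠ r.place j := fun h => hij (Equiv.injective (α := Fin m) r h)
  simp only [Ranking.Prefers, not_lt]
  exact ⟨le_of_lt, fun h => lt_of_le_of_ne h hne.symm⟩

theorem prefScore_swap (hij : i ≠ j) (r : Ranking m) : prefScore j i r = -prefScore i j r := by
  by_cases h : r.Prefers i j <;> simp [prefScore, Ranking.prefers_swap hij, h]

theorem prefScore_sq (i j : Fin m) (r : Ranking m) : prefScore i j r ^ 2 = 1 := by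
  by_cases h : r.Prefers i j <;> simp [prefScore, h]

theorem sum_prefScore (hij : i ≠ j) (σ : Fin n → Ranking m) :
    ∑ v, prefScore i j (σ v) = (votesFor σ i j : ℝ) - votesFor σ j i := by
  simp only [votesFor, Finset.card_filter, Nat.cast_sum, ← Finset.sum_sub_distrib]
  refine Finset.sum_congr rfl fun v _ => ?_
  by_cases h : (σ v).Prefers i j <;> simp [prefScore, Ranking.prefers_swap hij, h]

theorem beats_iff_sum_pos (hij : i ≠ j) (σ : Fin n → Ranking m) :
    Beats σ i j ↔ 0 < ∑ v, prefScore i j (σ v) := by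
  rw [sum_prefScore hij, sub_pos, Nat.cast_lt, Beats]

theorem isTie_iff_sum_eq_zero (hij : i ≠ j) (σ : Fin n → Ranking m) :
    IsTie σ i j ↔ ∑ v, prefScore i j (σ v) = 0 := by
  rw [sum_prefScore hij, sub_eq_zero, Nat.cast_inj, IsTie]

theorem IsCondorcetWinner.eq {σ : Fin n → Ranking m} (hi : IsCondorcetWinner σ i)
    (hj : IsCondorcetWinner σ j) : i = j := by
  by_contra hij
  exact lt_asymm (hi j (Ne.symm hij)) (hj i hij)

end Votes

/-! ### Moments of the scores -/

section Moments

variable {m : ℕ} (p : PMF (Ranking m))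

theorem memLp_prefScore (i j : Fin m) : MemLp (prefScore i j) 2 p.toMeasure :=
  MemLp.of_discrete

theorem lam_swap {i j : Fin m} (hij : i ≠ j) : lam p j i = -lam p i j := by
  simp only [lam, prefScore_swap hij, integral_neg]

theorem variance_prefScore {i j : Fin m} (h : lam p i j = 0) :
    Var[prefScore i j; p.toMeasure] = 1 := by
  rw [variance_eq_sub (memLp_prefScore p i j)]
  have : prefScore i j ^ 2 = fun _ : Ranking m => (1 : ℝ) := funext (prefScore_sq i j)
  rw [this, show ∫ r, prefScore i j r ∂p.toMeasure = 0 from h]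
  simp

theorem corrMatrix_eq_covariance {i : Fin m} {j l : Opponent i} (hj : lam p i j = 0)
    (hl : lam p i l = 0) :
    corrMatrix p i j l = cov[prefScore i j.1, prefScore i l.1; p.toMeasure] := by
  by_cases h : j = l
  · subst h
    rw [covariance_self (memLp_prefScore p i j).aestronglyMeasurable.aemeasurable,
      variance_prefScore p hj]
    simp [corrMatrix]
  · simp [corrMatrix, h, variance_prefScore p hj, variance_prefScore p hl]

/-- Scores divided by their standard deviations have a positive semidefinite covariance matrix. For
a constant score `s j = 0`, so the inverse is 0 and its row vanishes; the diagonal matrix `d`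
restores the missing 1. -/
theorem posSemidef_corrMatrix (i : Fin m) : (corrMatrix p i).PosSemidef := by
  let s (j : Opponent i) : ℝ := √Var[prefScore i j.1; p.toMeasure]
  let d (j : Opponent i) : ℝ := if Var[prefScore i j.1; p.toMeasure] = 0 then 1 else 0
  have h : corrMatrix p i = Matrix.of (fun j l => cov[fun r => (s j)⁻¹ * prefScore i j.1 r,
      fun r => (s l)⁻¹ * prefScore i l.1 r; p.toMeasure]) + Matrix.diagonal d := by
    ext j l
    rw [Matrix.add_apply, Matrix.of_apply, covariance_const_mul_left, covariance_const_mul_right]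
    by_cases hjl : j = l
    · subst hjl
      rw [covariance_self (memLp_prefScore p i j).aestronglyMeasurable.aemeasurable]
      by_cases h0 : Var[prefScore i j.1; p.toMeasure] = 0
      · simp [corrMatrix, d, h0]
      · have hs : s j ^ 2 = Var[prefScore i j.1; p.toMeasure] := Real.sq_sqrt (variance_nonneg _ _)
        have hs0 : s j ≠ 0 := fun h => h0 (by rw [← hs, h]; simp)
        rw [← hs, Matrix.diagonal_apply_eq, corrMatrix, if_pos rfl]
        simp only [d, h0, if_false]
        field_simp
        simp
    · simp only [corrMatrix, hjl, if_false, Matrix.diagonal_apply_ne _ hjl,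
        Real.sqrt_mul (variance_nonneg _ _), s]
      rw [div_eq_mul_inv, mul_inv]
      ring
  rw [h]
  refine (posSemidef_covariance fun j : Opponent i =>
    (memLp_prefScore p i j.1).const_mul (s j)⁻¹).add
    (Matrix.PosSemidef.diagonal fun j => ?_)
  by_cases h0 : Var[prefScore i j.1; p.toMeasure] = 0 <;> simp [d, h0]

theorem delta_eq_zero_iff {i : Fin m} {j : Opponent i} : delta p i j = 0 ↔ lam p i j = 0 := by
  rcases lt_trichotomy (lam p i j) 0 with h | h | h
  · simp [delta, h, h.ne, h.not_gt]
  · simp [delta, h]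
  · simp [delta, h, h.ne']

theorem delta_eq_top_iff {i : Fin m} {j : Opponent i} : delta p i j = ⊤ ↔ lam p i j < 0 := by
  rcases lt_trichotomy (lam p i j) 0 with h | h | h
  · simp [delta, h, h.not_gt]
  · simp [delta, h]
  · simp [delta, h, h.not_gt]

theorem delta_eq_bot {i : Fin m} {j : Opponent i} (h : 0 < lam p i j) : delta p i j = ⊥ :=
  if_pos h

end Moments

/-! ### Normal orthant probabilities -/

section Orthant

theorem isClosed_forall_nonneg (ι : Type*) :
    IsClosed {z : EuclideanSpace ℝ ι | ∀ k, 0 ≤ z k} := by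
  rw [Set.ofPred_forall]
  exact isClosed_iInter fun k => isClosed_le continuous_const (by fun_prop)

theorem normalOrthant_eq_zero {ι : Type*} [Fintype ι] [DecidableEq ι] {h : ι → EReal}
    (R : Matrix ι ι ℝ) (htop : ∃ k, h k = ⊤) : normalOrthant h R = 0 := by
  obtain ⟨k, hk⟩ := htop
  have : {z : EuclideanSpace ℝ ι | ∀ k, h k ≤ ((z k : ℝ) : EReal)} = ∅ := by
    refine Set.eq_empty_of_forall_notMem fun z hz => ?_
    simpa [hk] using hz k
  rw [normalOrthant, this, measureReal_empty]

/-- Coordinates with threshold `-∞` do not affect the orthant probability. -/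
theorem normalOrthant_eq_submatrix {ι : Type*} [Fintype ι] [DecidableEq ι] {h : ι → EReal}
    {R : Matrix ι ι ℝ} (hR : R.PosSemidef) (hh : ∀ k, h k = 0 ∨ h k = ⊥) :
    normalOrthant h R = normalOrthant (fun _ : {k // h k = 0} => (0 : EReal))
      (R.submatrix Subtype.val Subtype.val) := by
  rw [normalOrthant, normalOrthant, ← map_comp_multivariateGaussian _ hR,
    map_measureReal_apply (by fun_prop)]
  · congr 1
    ext z
    simp only [Set.mem_ofPred_eq, Set.preimage_ofPred_eq, Subtype.forall]
    refine forall_congr' fun k => ⟨fun hz hk => hk ▸ hz, fun hz => ?_⟩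
    rcases hh k with hk | hk
    · exact hk ▸ hz hk
    · simp [hk]
  · simp only [EReal.coe_nonneg]
    exact (isClosed_forall_nonneg _).measurableSet

theorem multivariateGaussian_coord_eq_zero {ι : Type*} [Fintype ι] [DecidableEq ι]
    {R : Matrix ι ι ℝ} (hR : R.PosSemidef) {k : ι} (hk : R k k = 1) :
    multivariateGaussian (0 : EuclideanSpace ℝ ι) R {z | z k = 0} = 0 := by
  have h := (measurePreserving_eval_multivariateGaussian (μ := 0) hR (i := k)).measure_preimage
    (measurableSet_singleton (0 : ℝ)).nullMeasurableSet
  rw [hk] at h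
  have := nullSingletonClass_gaussianReal (μ := (0 : EuclideanSpace ℝ ι) k)
    (v := (1 : ℝ).toNNReal) (by simp)
  rw [measure_singleton] at h
  exact h

end Orthant

/-! ### Limits of the election probabilities -/

section Limits

variable {m : ℕ} {p : PMF (Ranking m)} {Ω : Type*} [MeasurableSpace Ω] {P : Measure Ω}
  {V : ℕ → Ω → Ranking m}

theorem identDistrib_comp {E : Type*} [MeasurableSpace E] (hlaw : ∀ v, HasLaw (V v) p.toMeasure P)
    (f : Ranking m → E) (k : ℕ) :
    IdentDistrib (fun ω => f (V k ω)) (fun ω => f (V 0 ω)) P P :=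
  IdentDistrib.comp (u := f) ⟨(hlaw k).aemeasurable, (hlaw 0).aemeasurable,
    (hlaw k).map_eq.trans (hlaw 0).map_eq.symm⟩ (Measurable.of_discrete)

/-- The voters are only almost everywhere measurable, so events are null measurable; any set of
profiles is allowed because there are finitely many. -/
theorem nullMeasurableSet_profile (hlaw : ∀ v, HasLaw (V v) p.toMeasure P) {n : ℕ}
    (Q : (Fin n → Ranking m) → Prop) :
    NullMeasurableSet {ω | Q fun v : Fin n => V v ω} P :=
  (aemeasurable_pi_lambda _ fun v : Fin n => (hlaw v).aemeasurable).nullMeasurableSet_preimage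
    (Set.toFinite {σ | Q σ}).measurableSet

variable [IsProbabilityMeasure P]

theorem tendsto_measure_not_beats (hindep : iIndepFun V P)
    (hlaw : ∀ v, HasLaw (V v) p.toMeasure P) {i j : Fin m} (hij : i ≠ j) (hpos : 0 < lam p i j) :
    Tendsto (fun n : ℕ => P.real {ω | ¬ Beats (fun v : Fin n => V v ω) i j}) atTop (𝓝 0) := by
  have hf : AEStronglyMeasurable (prefScore i j) p.toMeasure :=
    (memLp_prefScore p i j).aestronglyMeasurable
  have h := tendsto_measure_sum_nonpos (P := P) (X := fun k ω => prefScore i j (V k ω)) ?_ ?_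
    (hindep.comp (fun _ => prefScore i j) fun _ => Measurable.of_discrete)
    (identDistrib_comp hlaw (prefScore i j))
  · simpa only [beats_iff_sum_pos hij, not_lt, Finset.sum_range] using h
  · refine Integrable.comp_aemeasurable (g := prefScore i j) ?_ (hlaw 0).aemeasurable
    rw [(hlaw 0).map_eq]
    exact (memLp_prefScore p i j).integrable (by norm_num)
  · exact hpos.trans_eq ((hlaw 0).integral_comp hf).symm

theorem tendsto_measure_beats_of_neg (hindep : iIndepFun V P)
    (hlaw : ∀ v, HasLaw (V v) p.toMeasure P) {i j : Fin m} (hij : i ≠ j) (hneg : lam p i j < 0) :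
    Tendsto (fun n : ℕ => P.real {ω | Beats (fun v : Fin n => V v ω) i j}) atTop (𝓝 0) :=
  squeeze_zero (fun _ => measureReal_nonneg) (fun _ => measureReal_mono fun _ h => lt_asymm h)
    (tendsto_measure_not_beats hindep hlaw hij.symm (by rw [lam_swap p hij]; linarith))

/-- The normalised vote margins of a candidate against opponents with whom it is balanced are
asymptotically normal. -/
theorem tendsto_measure_margins {κ : Type*} [Fintype κ] [DecidableEq κ] (hindep : iIndepFun V P)
    (hlaw : ∀ v, HasLaw (V v) p.toMeasure P) {i : Fin m} (e : κ → Opponent i)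
    (he : ∀ k, lam p i (e k) = 0) {E : Set (EuclideanSpace ℝ κ)} (hE : MeasurableSet E)
    (hfr : multivariateGaussian (0 : EuclideanSpace ℝ κ) ((corrMatrix p i).submatrix e e)
      (frontier E) = 0) :
    Tendsto (fun n : ℕ => P.real {ω | (WithLp.toLp 2 fun k => (√n)⁻¹ *
        ∑ v : Fin n, prefScore i (e k).1 (V v ω)) ∈ E}) atTop
      (𝓝 ((multivariateGaussian (0 : EuclideanSpace ℝ κ)
        ((corrMatrix p i).submatrix e e)).real E)) := by
  let f (r : Ranking m) : EuclideanSpace ℝ κ := WithLp.toLp 2 fun k => prefScore i (e k).1 r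
  have hf : MemLp f 2 p.toMeasure := MemLp.of_discrete
  have hclt := tendstoInDistribution_inv_sqrt_smul_sum (P := P) (X := fun v ω => f (V v ω))
    (S := (corrMatrix p i).submatrix e e) ?_ ?_ ?_
    (hindep.comp (fun _ => f) fun _ => Measurable.of_discrete) (identDistrib_comp hlaw f)
  · have h := ProbabilityMeasure.tendsto_measure_of_null_frontier_of_tendsto' hclt.tendsto
      (E := E) (by simpa using hfr)
    simp only [ProbabilityMeasure.coe_mk, Measure.map_id] at h
    refine ((ENNReal.tendsto_toReal (measure_ne_top _ _)).comp h).congr fun n => ?_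
    rw [Function.comp_apply, Measure.map_apply_of_aemeasurable (hclt.forall_aemeasurable n) hE,
      measureReal_def]
    congr 2
    ext ω
    have : (√n)⁻¹ • ∑ v ∈ Finset.range n, f (V v ω) =
        WithLp.toLp 2 fun k => (√n)⁻¹ * ∑ v : Fin n, prefScore i (e k).1 (V v ω) := by
      ext k
      simp [f, Finset.sum_range]
    simp only [Set.mem_preimage, this, Set.mem_ofPred_eq]
  · refine MemLp.comp_of_map (g := f) ?_ (hlaw 0).aemeasurable
    rwa [(hlaw 0).map_eq]
  · refine ((hlaw 0).integral_comp hf.aestronglyMeasurable).trans ?_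
    ext k
    have := (EuclideanSpace.proj (𝕜 := ℝ) k).integral_comp_comm (hf.integrable (by norm_num))
    exact this.symm.trans (he k)
  · intro j l
    exact ((hlaw 0).covariance_fun_comp (f := prefScore i (e j).1) (g := prefScore i (e l).1)
      Measurable.of_discrete.aemeasurable Measurable.of_discrete.aemeasurable).trans
      (corrMatrix_eq_covariance p (he j) (he l)).symm

theorem tendsto_measure_forall_beats {κ : Type*} [Fintype κ] [DecidableEq κ]
    (hindep : iIndepFun V P) (hlaw : ∀ v, HasLaw (V v) p.toMeasure P) {i : Fin m}
    (e : κ → Opponent i) (he : ∀ k, lam p i (e k) = 0) :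
    Tendsto (fun n : ℕ => P.real {ω | ∀ k, Beats (fun v : Fin n => V v ω) i (e k)}) atTop
      (𝓝 (normalOrthant (fun _ => 0) ((corrMatrix p i).submatrix e e))) := by
  set R := (corrMatrix p i).submatrix e e
  have hnull : multivariateGaussian (0 : EuclideanSpace ℝ κ) R (⋃ k, {z | z k = 0}) = 0 :=
    measure_iUnion_null fun k => multivariateGaussian_coord_eq_zero
      ((posSemidef_corrMatrix p i).submatrix e) (by simp [corrMatrix])
  have hopen : IsOpen {z : EuclideanSpace ℝ κ | ∀ k, 0 < z k} := by
    rw [Set.ofPred_forall]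
    exact isOpen_iInter_of_finite fun k => isOpen_lt continuous_const (by fun_prop)
  have hdiff : {z : EuclideanSpace ℝ κ | ∀ k, 0 ≤ z k} \ {z | ∀ k, 0 < z k} ⊆
      ⋃ k, {z | z k = 0} := by
    rintro z ⟨h0, h1⟩
    simp only [Set.mem_ofPred_eq, not_forall, not_lt, Set.mem_iUnion] at h0 h1 ⊢
    obtain ⟨k, hk⟩ := h1
    exact ⟨k, le_antisymm hk (h0 k)⟩
  have hsub : {z : EuclideanSpace ℝ κ | ∀ k, 0 < z k} ⊆ {z | ∀ k, 0 ≤ z k} :=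
    fun z hz k => (hz k).le
  have h := tendsto_measure_margins hindep hlaw e he hopen.measurableSet <| by
    refine measure_mono_null (fun z hz => ?_) hnull
    rw [hopen.frontier_eq] at hz
    exact hdiff ⟨closure_minimal hsub (isClosed_forall_nonneg κ) hz.1, hz.2⟩
  have hG : normalOrthant (fun _ => 0) R =
      (multivariateGaussian (0 : EuclideanSpace ℝ κ) R).real {z | ∀ k, 0 < z k} := by
    simp only [normalOrthant, EReal.coe_nonneg]
    exact congrArg ENNReal.toReal (measure_eq_measure_of_null_sdiff hsub
      (measure_mono_null hdiff hnull)).symm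
  rw [hG]
  refine h.congr fun n => ?_
  congr 1
  ext ω
  refine forall_congr' fun k => ?_
  rw [beats_iff_sum_pos (e k).2.symm]
  -- For `n = 0` the sum is empty and both sides read `0 < 0`; otherwise the positive scale cancels.
  rcases Nat.eq_zero_or_pos n with rfl | hn
  · simp
  · exact mul_pos_iff_of_pos_left (by positivity)

/-- A balanced pair ties when its one-dimensional margin lies in the closed null set `{0}`; an
unbalanced tie is a failure of the favourite to win. -/
theorem tendsto_measure_isTie (hindep : iIndepFun V P) (hlaw : ∀ v, HasLaw (V v) p.toMeasure P)
    {i j : Fin m} (hij : i ≠ j) :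
    Tendsto (fun n : ℕ => P.real {ω | IsTie (fun v : Fin n => V v ω) i j}) atTop (𝓝 0) := by
  rcases lt_trichotomy (lam p i j) 0 with h | h | h
  · exact squeeze_zero (fun _ => measureReal_nonneg)
      (fun _ => measureReal_mono fun _ ht => ht.not_lt)
      (tendsto_measure_not_beats hindep hlaw hij.symm (by rw [lam_swap p hij]; linarith))
  · let e (_ : Unit) : Opponent i := ⟨j, hij.symm⟩
    have hcl : IsClosed {z : EuclideanSpace ℝ Unit | z () = 0} :=
      isClosed_eq (by fun_prop) continuous_const
    have hnull : multivariateGaussian (0 : EuclideanSpace ℝ Unit)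
        ((corrMatrix p i).submatrix e e) {z | z () = 0} = 0 :=
      multivariateGaussian_coord_eq_zero ((posSemidef_corrMatrix p i).submatrix e)
        (by simp [corrMatrix])
    have key := tendsto_measure_margins hindep hlaw e (fun _ => h) hcl.measurableSet
      (measure_mono_null hcl.frontier_subset hnull)
    rw [measureReal_def, hnull, ENNReal.toReal_zero] at key
    refine squeeze_zero (fun _ => measureReal_nonneg)
      (fun n => measureReal_mono fun ω hω => ?_) key
    rw [Set.mem_ofPred_eq, isTie_iff_sum_eq_zero hij] at hω
    simp [e, hω]
  · exact squeeze_zero (fun _ => measureReal_nonneg)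
      (fun _ => measureReal_mono fun _ ht => ht.symm.not_lt)
      (tendsto_measure_not_beats hindep hlaw hij h)

theorem normalOrthant_delta_eq_submatrix {i : Fin m} (h : ∀ j, delta p i j ≠ ⊤) :
    normalOrthant (delta p i) (corrMatrix p i) =
      normalOrthant (fun _ : {j : Opponent i // delta p i j = 0} => (0 : EReal))
        ((corrMatrix p i).submatrix Subtype.val Subtype.val) := by
  refine normalOrthant_eq_submatrix (posSemidef_corrMatrix p i) fun j => ?_
  have hj := h j
  rw [Ne, delta_eq_top_iff, not_lt] at hj
  rcases hj.eq_or_lt with h0 | h0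
  · exact Or.inl ((delta_eq_zero_iff p).2 h0.symm)
  · exact Or.inr (delta_eq_bot p h0)

/-- If no opponent is fatal, winning implies beating all balanced opponents, and by a union bound
the two probabilities differ by at most the chance of failing to beat some weaker opponent. -/
theorem tendsto_measure_isCondorcetWinner (hindep : iIndepFun V P)
    (hlaw : ∀ v, HasLaw (V v) p.toMeasure P) (i : Fin m) :
    Tendsto (fun n : ℕ => P.real {ω | IsCondorcetWinner (fun v : Fin n => V v ω) i}) atTop
      (𝓝 (normalOrthant (delta p i) (corrMatrix p i))) := by
  by_cases htop : ∃ j, delta p i j = ⊤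
  · rw [normalOrthant_eq_zero _ htop]
    obtain ⟨j, hj⟩ := htop
    exact squeeze_zero (fun _ => measureReal_nonneg)
      (fun _ => measureReal_mono fun _ h => h j.1 j.2)
      (tendsto_measure_beats_of_neg hindep hlaw j.2.symm ((delta_eq_top_iff p).1 hj))
  · push Not at htop
    rw [normalOrthant_delta_eq_submatrix htop]
    have hbal := tendsto_measure_forall_beats hindep hlaw
      (fun k : {j : Opponent i // delta p i j = 0} => k.1) fun k => (delta_eq_zero_iff p).1 k.2
    have hpos : Tendsto (fun n : ℕ => ∑ k : {j : Opponent i // delta p i j ≠ 0},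
        P.real {ω | ¬ Beats (fun v : Fin n => V v ω) i k.1}) atTop (𝓝 0) := by
      have hk (k : {j : Opponent i // delta p i j ≠ 0}) : 0 < lam p i k.1 :=
        lt_of_le_of_ne (not_lt.1 fun h => htop k.1 ((delta_eq_top_iff p).2 h))
          fun h => k.2 ((delta_eq_zero_iff p).2 h.symm)
      simpa only [Finset.sum_const_zero] using tendsto_finsetSum Finset.univ fun k _ =>
        tendsto_measure_not_beats hindep hlaw k.1.2.symm (hk k)
    have hlow := hbal.sub hpos
    rw [sub_zero] at hlow
    refine tendsto_of_tendsto_of_tendsto_of_le_of_le hlow hbal (fun n => ?_)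
      fun n => measureReal_mono fun ω h k => h k.1.1 k.1.2
    rw [sub_le_iff_le_add]
    refine (measureReal_mono (s₂ := {ω | IsCondorcetWinner (fun v : Fin n => V v ω) i} ∪
      ⋃ k : {j : Opponent i // delta p i j ≠ 0}, {ω | ¬ Beats (fun v : Fin n => V v ω) i k.1})
      fun ω hω => ?_).trans ((measureReal_union_le _ _).trans
        (add_le_add_right (measureReal_iUnion_fintype_le _) _))
    by_cases hk : ∃ k : {j : Opponent i // delta p i j ≠ 0},
        ¬ Beats (fun v : Fin n => V v ω) i k.1
    · exact Or.inr (Set.mem_iUnion.2 hk)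
    · push Not at hk
      refine Or.inl fun j hj => ?_
      by_cases h0 : delta p i ⟨j, hj⟩ = 0
      · exact hω ⟨⟨j, hj⟩, h0⟩
      · exact hk ⟨⟨j, hj⟩, h0⟩

theorem measure_exists_isCondorcetWinner (hlaw : ∀ v, HasLaw (V v) p.toMeasure P) (n : ℕ) :
    P.real {ω | ∃ i, IsCondorcetWinner (fun v : Fin n => V v ω) i} =
      ∑ i, P.real {ω | IsCondorcetWinner (fun v : Fin n => V v ω) i} := by
  -- Uniqueness of the winner makes the events disjoint.
  rw [Set.ofPred_exists, measureReal_def, measure_iUnion₀, tsum_fintype,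
    ENNReal.toReal_sum fun _ _ => measure_ne_top _ _]
  · rfl
  · exact fun i j hij => (Set.disjoint_left.2 fun ω hi hj => hij (hi.eq hj)).aedisjoint
  · exact fun i => nullMeasurableSet_profile hlaw fun σ => IsCondorcetWinner σ i

end Limits

theorem mainTheorem1 (m : ℕ) (p : PMF (Ranking m))
    {Ω : Type*} [MeasurableSpace Ω] (P : Measure Ω) [IsProbabilityMeasure P]
    (V : ℕ → Ω → Ranking m) (hindep : iIndepFun V P)
    (hlaw : ∀ v, HasLaw (V v) p.toMeasure P) :
    -- each `R_i` is a genuine covariance matrix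
    (∀ i, (corrMatrix p i).PosSemidef) ∧
    -- limit of the probability that `i` is the Condorcet winner among `n` voters
    (∀ i, Tendsto (fun n : ℕ => P.real {ω | IsCondorcetWinner (fun v : Fin n => V v ω) i}) atTop
      (𝓝 (normalOrthant (delta p i) (corrMatrix p i)))) ∧
    -- limit of the probability that there is a Condorcet winner
    Tendsto (fun n : ℕ => P.real {ω | ∃ i, IsCondorcetWinner (fun v : Fin n => V v ω) i}) atTop
      (𝓝 (∑ i, normalOrthant (delta p i) (corrMatrix p i))) ∧
    -- an `L` with an argument `+∞` vanishes
    (∀ i, (∃ j, delta p i j = ⊤) → normalOrthant (delta p i) (corrMatrix p i) = 0) ∧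
    -- otherwise `L` is the positive orthant probability of the marginal on `{j | δ_{ij} = 0}`
    (∀ i, (∀ j, delta p i j ≠ ⊤) →
      normalOrthant (delta p i) (corrMatrix p i) =
        normalOrthant (fun _ : {j : Opponent i // delta p i j = 0} => (0 : EReal))
          ((corrMatrix p i).submatrix Subtype.val Subtype.val)) ∧
    -- the probability of a tie tends to zero
    (∀ i j, i ≠ j →
      Tendsto (fun n : ℕ => P.real {ω | IsTie (fun v : Fin n => V v ω) i j}) atTop (𝓝 0)) :=
  ⟨posSemidef_corrMatrix p, tendsto_measure_isCondorcetWinner hindep hlaw,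
    (tendsto_finsetSum _ fun i _ => tendsto_measure_isCondorcetWinner hindep hlaw i).congr
      fun n => (measure_exists_isCondorcetWinner hlaw n).symm,
    fun _ => normalOrthant_eq_zero _, fun _ => normalOrthant_delta_eq_submatrix,
    fun _ _ => tendsto_measure_isTie hindep hlaw⟩
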